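/- Let $r\in\{1,2,\dots\}\cup\{\infty\}$, let $d\ge 0$ be an integer and let $M$ be a $d$-dimensional Hausdorff $C^r$-manifold without boundary (not necessarily connected, paracompact or second countable). For a set $I$, let $\mathbb R^I$ be the locally convex space with the product topology. $C^r$-maps into, out of and between (open subsets of) locally convex spaces are understood in the sense of Michal–Bastiani: all iterated directional derivatives $d^kf(x;v_1,\dots,v_k)$ with $k\le r$ exist and are jointly continuous in $(x,v_1,\dots,v_k)$. A subset $N\subseteq\mathbb R^I$ is a $C^r$-submanifold modelled on a closed vector subspace $F\subseteq\mathbb R^I$ if for each $p\in N$ there is a $C^r$-diffeomorphism $\phi\colon U\to V$ between open subsets of $\mathbb R^I$ with $p\in U$ and $\phi(U\cap N)=V\cap F$; then $N$ is a $C^r$-manifold with the charts $\phi|_{U\cap N}\colon U\cap N\to V\cap F$. A $C^r$-embedding of $M$ into $\mathbb R^I$ is a $C^r$-map $f\colon M\to\mathbb R^I$ such that $f(M)$ is a $C^r$-submanifold of $\mathbb R^I$ and $M\to f(M)$, $x\mapsto f(x)$, is a $C^r$-diffeomorphism. Theorem B. There is a set $I$ such that $M$ admits a $C^r$-embedding into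 $\mathbb R^I$. Let $\operatorname{embdim}(M)$ be the least cardinality $|I|$ of such a set $I$, and let $c(M)$ be the number (cardinality of the set) of connected components of $M$. Then: (a) $\operatorname{embdim}(M)$ is finite if and only if $M$ is second countable. (b) If $M$ is not second countable and $c(M)\le 2^{\aleph_0}$, then $\aleph_1\le\operatorname{embdim}(M)\le 2^{\aleph_0}$. (c) If $c(M)\ge 2^{\aleph_0}$, then $\operatorname{embdim}(M)=c(M)$. In particular, for every such $M$, $\operatorname{embdim}(M)\ne\aleph_0$. -/

import Mathlib

open Set Filter Topology
open scoped Cardinal Manifold ContDiff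

universe u v

section Calculus

variable {E : Type u} {F : Type v}
  [AddCommGroup E] [Module ℝ E] [TopologicalSpace E]
  [AddCommGroup F] [Module ℝ F] [TopologicalSpace F]

/-- `f` is a `C^r`-map in the sense of Michal-Bastiani (Keller's `C_c^r`) on the open set `U` of the
(Hausdorff, locally convex) real topological vector space `E`: the iterated directional derivatives
`D k x (v₁, …, v_k)` of `f` exist at every `x ∈ U`, for all directions `v₁, …, v_k` and all `k ≤ r`,
and each `D k` is jointly continuous on `U × E^k`.  (The direction of the last differentiation is
written first.) -/
def MBContDiffOn (r : ℕ∞) (f : E → F) (U : Set E) : Prop :=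
  ∃ D : (k : ℕ) → E → (Fin k → E) → F,
    (∀ x ∈ U, ∀ v : Fin 0 → E, D 0 x v = f x) ∧
    (∀ k : ℕ, ((k + 1 : ℕ) : ℕ∞) ≤ r → ∀ x ∈ U, ∀ (v : Fin k → E) (w : E),
      Tendsto (fun t : ℝ => t⁻¹ • (D k (x + t • w) v - D k x v)) (𝓝[≠] 0)
        (𝓝 (D (k + 1) x (Fin.cons w v : Fin (k + 1) → E)))) ∧
    (∀ k : ℕ, (k : ℕ∞) ≤ r →
      ContinuousOn (fun p : E × (Fin k → E) => D k p.1 p.2) (U ×ˢ (univ : Set (Fin k → E))))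

/-- A homeomorphism `φ` between an open subset of `E` and an open subset of `F` is a
`C^r`-diffeomorphism. -/
def IsMBDiffeo (r : ℕ∞) (φ : OpenPartialHomeomorph E F) : Prop :=
  MBContDiffOn r φ φ.source ∧ MBContDiffOn r φ.symm φ.target

/-- `φ` is a `C^r`-diffeomorphism between open subsets `U` and `V` of `E`
with `φ(U ∩ N) = V ∩ F`. -/
def IsSliceChart (r : ℕ∞) (N : Set E) (F : Submodule ℝ E) (φ : OpenPartialHomeomorph E E) : Prop :=
  IsMBDiffeo r φ ∧ φ '' (φ.source ∩ N) = φ.target ∩ (F : Set E)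

/-- `N ⊆ E` is a `C^r`-submanifold of `E` modelled on the closed vector subspace `F` of `E`. -/
def IsMBSubmanifold (r : ℕ∞) (N : Set E) (F : Submodule ℝ E) : Prop :=
  IsClosed (F : Set E) ∧
    ∀ p ∈ N, ∃ φ : OpenPartialHomeomorph E E, p ∈ φ.source ∧ IsSliceChart r N F φ

end Calculus

section Embeddings

variable (d : ℕ) (r : ℕ∞) {M : Type u} [TopologicalSpace M]
  [ChartedSpace (EuclideanSpace ℝ (Fin d)) M]
  {E : Type v} [AddCommGroup E] [Module ℝ E] [TopologicalSpace E]

/-- `f : M → E` is a `C^r`-map from the `d`-dimensional manifold `M` to the locally convex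
space `E`: it is `C^r` in every chart of the atlas. -/
def MBContMDiff (f : M → E) : Prop :=
  ∀ ψ ∈ atlas (EuclideanSpace ℝ (Fin d)) M, MBContDiffOn r (f ∘ ψ.symm) ψ.target

/-- `M → f(M)`, `x ↦ f x`, is a `C^r`-diffeomorphism, where `f(M)` is a `C^r`-submanifold of `E`
modelled on `F`, with its manifold structure given by the restrictions `U ∩ f(M) → V ∩ F` of the
slice charts: it is a homeomorphism for the subspace topology on `f(M)`, and around every point `x`
its representative `e = φ ∘ f ∘ ψ⁻¹` in charts `ψ` of `M` and `φ` of `f(M)`, a map from an open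
subset of `ℝ^d` to `F`, is a `C^r`-diffeomorphism onto an open subset of `F`. -/
def IsMBDiffeoOntoRange (f : M → E) (F : Submodule ℝ E) : Prop :=
  IsEmbedding f ∧
    ∀ x : M, ∃ φ : OpenPartialHomeomorph E E, f x ∈ φ.source ∧ IsSliceChart r (range f) F φ ∧
      ∃ e : OpenPartialHomeomorph (EuclideanSpace ℝ (Fin d)) F,
        e.source = (chartAt (EuclideanSpace ℝ (Fin d)) x).target ∩
          (chartAt (EuclideanSpace ℝ (Fin d)) x).symm ⁻¹' (f ⁻¹' φ.source) ∧
        (∀ z ∈ e.source, (e z : E) = φ (f ((chartAt (EuclideanSpace ℝ (Fin d)) x).symm z))) ∧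
        IsMBDiffeo r e

/-- `f : M → E` is a `C^r`-embedding: a `C^r`-map whose image is a `C^r`-submanifold of `E`, such
that `M → f(M)` is a `C^r`-diffeomorphism. -/
def IsMBEmbedding (f : M → E) : Prop :=
  MBContMDiff d r f ∧
    ∃ F : Submodule ℝ E, IsMBSubmanifold r (range f) F ∧ IsMBDiffeoOntoRange d r f F

variable (M)

/-- The cardinals `|I|` of the sets `I` such that there is a `C^r`-embedding of `M` into the
locally convex space `ℝ^I` (with the product topology). -/
def embeddingCardinals : Set Cardinal.{u} :=
  {κ | ∃ I : Type u, #I = κ ∧ ∃ f : M → (I → ℝ), IsMBEmbedding d r f}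

/-- The embedding dimension of `M`: the least `|I|` such that `M` can be `C^r`-embedded
into `ℝ^I`. -/
noncomputable def embdim : Cardinal.{u} :=
  sInf (embeddingCardinals d r M)

end Embeddings

/-! ### Michal–Bastiani calculus: the few closure properties needed -/

section MichalBastianiCalculus

/-! The main tool is an embedding criterion (`isMBEmbedding_joinCoord`) that avoids the inverse
function theorem. Suppose that near each point a chart `ψ` equals `ζ (P (g y))`, where `P` is
continuous linear into a normed space. The shears `(a, b) ↦ (a + ζ (P b), b)` and `(a, b) ↦ (a, b -
g (ψ⁻¹ a))` then send `(0, g y)` first to `(ψ y, g y)` and then to `(ψ y, 0)`. They flatten the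
image of `(0, g)` at the cost of `d` extra coordinates.

Such `g` come from coloured charts (`exists_isMBEmbedding_of_colouring`). Each colour contributes a
weight `ρ`, a labelled weight `h` and a weighted chart `ξ`. The quotient `h / ρ` tells which chart
is active, and `ξ / ρ` recovers it. Using every point as a colour embeds any Hausdorff `M` with `d +
(2 + d) |M|` coordinates. If `M` is second countable, `d + 1` colours suffice: generic levels of
bump functions cut `M` into cells, each inside a chart, and cells of equal colour are disjoint.

The rest is counting. A component has at most `𝔠` points, since it is generated from one point by
chart parametrizations and limits of sequences; hence `|M| ≤ max (c(M)) 𝔠`. Conversely, components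
are open and so are separated by finite families of rational conditions on coordinates, giving `c(M)
≤ max |I| ℵ₀`. Finally, countable `I` forces `M` to be second countable, hence finitely embeddable;
this excludes `ℵ₀` as a value. -/

theorem MBContDiffOn.of_contDiffOn {E F : Type*} [NormedAddCommGroup E] [NormedSpace ℝ E]
    [NormedAddCommGroup F] [NormedSpace ℝ F] {r : ℕ∞} {f : E → F} {U : Set E} (hU : IsOpen U)
    (hf : ContDiffOn ℝ r f U) : MBContDiffOn r f U := by
  refine ⟨fun k x v => iteratedFDeriv ℝ k f x v, fun x _ v => by simp, ?_, ?_⟩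
  · intro k hk x hx v w
    have hdiff : DifferentiableAt ℝ (iteratedFDeriv ℝ k f) x := by
      refine (hf.contDiffAt (hU.mem_nhds hx)).differentiableAt_iteratedFDeriv ?_
      have : (k : ℕ∞) < r := lt_of_lt_of_le (by exact_mod_cast Nat.lt_succ_self k) hk
      exact_mod_cast this
    have h1 : HasFDerivAt (fun y => iteratedFDeriv ℝ k f y v)
        ((ContinuousMultilinearMap.apply ℝ (fun _ : Fin k => E) F v).comp
          (fderiv ℝ (iteratedFDeriv ℝ k f) x)) x :=
      ((ContinuousMultilinearMap.apply ℝ (fun _ : Fin k => E) F v).hasFDerivAt).comp x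
        hdiff.hasFDerivAt
    have h2 := (h1.hasLineDerivAt w)
    simp only [iteratedFDeriv_succ_apply_left]
    simpa using h2.tendsto_slope_zero
  · intro k hk
    have hc : ContinuousOn (iteratedFDeriv ℝ k f) U := by
      have h := hf.continuousOn_iteratedFDerivWithin (m := k) (by exact_mod_cast hk) hU.uniqueDiffOn
      exact h.congr fun x hx => (iteratedFDerivWithin_of_isOpen k hU hx).symm
    have h1 : ContinuousOn (fun p : E × (Fin k → E) => iteratedFDeriv ℝ k f p.1) (U ×ˢ univ) :=
      hc.comp continuousOn_fst fun p hp => hp.1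
    exact (continuous_eval (F := E [×k]→L[ℝ] F)).comp_continuousOn (h1.prodMk continuousOn_snd)

section

variable {E F G : Type*} [AddCommGroup E] [Module ℝ E] [TopologicalSpace E]
  [AddCommGroup F] [Module ℝ F] [TopologicalSpace F]
  [AddCommGroup G] [Module ℝ G] [TopologicalSpace G] {r : ℕ∞}

/-- For a linear inner map the chain rule has a single term: the `k`-th derivative is `D k (L x) (L
∘ v)`. No general chain rule is needed later. -/
theorem MBContDiffOn.comp_clm {f : F → G} {U : Set E} {V : Set F} (hf : MBContDiffOn r f V)
    (L : E →L[ℝ] F) (hL : MapsTo L U V) : MBContDiffOn r (f ∘ L) U := by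
  obtain ⟨D, h0, h1, h2⟩ := hf
  refine ⟨fun k x v => D k (L x) (L ∘ v), fun x hx v => h0 _ (hL hx) _, ?_, ?_⟩
  · intro k hk x hx v w
    have := h1 k hk (L x) (hL hx) (L ∘ v) (L w)
    simp only [map_add, map_smul]
    convert this using 3
    ext i
    refine Fin.cases ?_ (fun j => ?_) i <;> simp
  · intro k hk
    have hc : Continuous fun p : E × (Fin k → E) => (L p.1, L ∘ p.2) := by
      refine (L.continuous.comp continuous_fst).prodMk (continuous_pi fun i => ?_)
      exact L.continuous.comp ((continuous_apply i).comp continuous_snd)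
    exact (h2 k hk).comp hc.continuousOn fun p hp => ⟨hL hp.1, mem_univ _⟩

theorem MBContDiffOn.of_clm (L : E →L[ℝ] F) (U : Set E) : MBContDiffOn r L U := by
  refine ⟨fun k => match k with
    | 0 => fun x _ => L x
    | 1 => fun _ v => L (v 0)
    | _ + 2 => fun _ _ => 0, fun x _ v => rfl, ?_, ?_⟩
  · rintro (_ | _ | k) _ x _ v w
    · refine tendsto_const_nhds.congr' ?_
      filter_upwards [self_mem_nhdsWithin] with t ht
      simp [smul_smul, inv_mul_cancel₀ (show t ≠ 0 from ht)]
    · simpa using tendsto_const_nhds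
    · simpa using tendsto_const_nhds
  · rintro (_ | _ | k) _
    · exact (L.continuous.comp continuous_fst).continuousOn
    · exact (L.continuous.comp ((continuous_apply 0).comp continuous_snd)).continuousOn
    · exact continuousOn_const

theorem MBContDiffOn.pi {I : Type*} {f : E → I → ℝ} {U : Set E}
    (hf : ∀ i, MBContDiffOn r (fun x => f x i) U) : MBContDiffOn r f U := by
  choose D h0 h1 h2 using hf
  refine ⟨fun k x v i => D i k x v, fun x hx v => funext fun i => h0 i x hx v, ?_, ?_⟩
  · intro k hk x hx v w
    exact tendsto_pi_nhds.2 fun i => h1 i k hk x hx v w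
  · intro k hk
    exact continuousOn_pi.2 fun i => h2 i k hk

end

/-- A map into a power of the real line is a Michal-Bastiani `C^r`-map if each of its coordinates
factors through a `C^r`-function on an open subset of a normed space. -/
theorem MBContDiffOn.pi_of_factors {E : Type*} [AddCommGroup E] [Module ℝ E] [TopologicalSpace E]
    {I : Type*} {r : ℕ∞} {f : E → I → ℝ} {U : Set E} {G : Type*} [NormedAddCommGroup G]
    [NormedSpace ℝ G] (h : ∀ i, ∃ (L : E →L[ℝ] G) (V : Set G) (k : G → ℝ), IsOpen V ∧ MapsTo L U V ∧
      ContDiffOn ℝ r k V ∧ ∀ x ∈ U, f x i = k (L x)) : MBContDiffOn r f U := by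
  refine .pi fun i => ?_
  obtain ⟨L, V, k, hV, hL, hk, he⟩ := h i
  obtain ⟨D, h0, h1, h2⟩ := (MBContDiffOn.of_contDiffOn hV hk).comp_clm L hL
  exact ⟨D, fun x hx v => (h0 x hx v).trans (he x hx).symm, h1, h2⟩

end MichalBastianiCalculus

theorem MBContDiffOn.continuousOn {E F : Type*} [AddCommGroup E] [Module ℝ E] [TopologicalSpace E]
    [AddCommGroup F] [Module ℝ F] [TopologicalSpace F] {r : ℕ∞} {f : E → F} {U : Set E}
    (hf : MBContDiffOn r f U) : ContinuousOn f U := by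
  obtain ⟨D, h0, -, h2⟩ := hf
  have h := (h2 0 (by simp)).comp (f := fun x : E => (x, (Fin.elim0 : Fin 0 → E))) (s := U)
    (continuousOn_id.prodMk continuousOn_const) fun x hx => ⟨hx, mem_univ _⟩
  exact h.congr fun x hx => (h0 x hx _).symm

/-! ### Slice charts built from two shears -/

section SliceCharts

variable {d : ℕ} {J : Type u}

/-- The projection of `ℝ^d × ℝ^J` onto `ℝ^d`. -/
noncomputable def eucProj (d : ℕ) (J : Type u) :
    (Fin d ⊕ J → ℝ) →L[ℝ] EuclideanSpace ℝ (Fin d) :=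
  ((EuclideanSpace.equiv (Fin d) ℝ).symm : (Fin d → ℝ) →L[ℝ] EuclideanSpace ℝ (Fin d)).comp
    (ContinuousLinearMap.pi fun j => ContinuousLinearMap.proj (Sum.inl j))

/-- The projection of `ℝ^d × ℝ^J` onto `ℝ^J`. -/
noncomputable def coordProj (d : ℕ) (J : Type u) : (Fin d ⊕ J → ℝ) →L[ℝ] (J → ℝ) :=
  ContinuousLinearMap.pi fun j => ContinuousLinearMap.proj (Sum.inr j)

/-- The point `(a, b)` of `ℝ^d × ℝ^J`. -/
def joinCoord (a : EuclideanSpace ℝ (Fin d)) (b : J → ℝ) : Fin d ⊕ J → ℝ :=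
  Sum.elim a b

@[simp] theorem eucProj_apply (y : Fin d ⊕ J → ℝ) (j : Fin d) :
    eucProj d J y j = y (Sum.inl j) := rfl

@[simp] theorem coordProj_apply (y : Fin d ⊕ J → ℝ) (j : J) :
    coordProj d J y j = y (Sum.inr j) := rfl

@[simp] theorem joinCoord_inl (a : EuclideanSpace ℝ (Fin d)) (b : J → ℝ) (j : Fin d) :
    joinCoord a b (Sum.inl j) = a j := rfl

@[simp] theorem joinCoord_inr (a : EuclideanSpace ℝ (Fin d)) (b : J → ℝ) (j : J) :
    joinCoord a b (Sum.inr j) = b j := rfl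

@[simp] theorem eucProj_joinCoord (a : EuclideanSpace ℝ (Fin d)) (b : J → ℝ) :
    eucProj d J (joinCoord a b) = a := by ext j; simp

@[simp] theorem coordProj_joinCoord (a : EuclideanSpace ℝ (Fin d)) (b : J → ℝ) :
    coordProj d J (joinCoord a b) = b := by ext j; simp

@[simp] theorem joinCoord_proj (y : Fin d ⊕ J → ℝ) :
    joinCoord (eucProj d J y) (coordProj d J y) = y := by
  ext (j | j) <;> simp

/-- The subspace `ℝ^d × {0}` of `ℝ^d × ℝ^J`. -/
noncomputable def eucSubmodule (d : ℕ) (J : Type u) : Submodule ℝ (Fin d ⊕ J → ℝ) :=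
  LinearMap.ker (coordProj d J : (Fin d ⊕ J → ℝ) →ₗ[ℝ] (J → ℝ))

theorem mem_eucSubmodule {y : Fin d ⊕ J → ℝ} : y ∈ eucSubmodule d J ↔ coordProj d J y = 0 :=
  Iff.rfl

theorem isClosed_eucSubmodule : IsClosed (eucSubmodule d J : Set (Fin d ⊕ J → ℝ)) :=
  ContinuousLinearMap.isClosed_ker (coordProj d J)

/-- The isomorphism of `ℝ^d` with `ℝ^d × {0}`. -/
noncomputable def eucEquiv (d : ℕ) (J : Type u) :
    EuclideanSpace ℝ (Fin d) ≃L[ℝ] eucSubmodule d J where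
  toFun a := ⟨joinCoord a 0, by simp [mem_eucSubmodule]⟩
  invFun y := eucProj d J y
  map_add' a b := by ext (j | j) <;> simp
  map_smul' c a := by ext (j | j) <;> simp
  left_inv a := by simp
  right_inv y := by
    have h := mem_eucSubmodule.1 y.2
    ext1
    simp only [← h, joinCoord_proj]
  continuous_toFun := by
    refine Continuous.subtype_mk (continuous_pi ?_) _
    rintro (j | j)
    · simp only [joinCoord_inl]; fun_prop
    · simp only [joinCoord_inr]; exact continuous_const
  continuous_invFun := (eucProj d J).continuous.comp continuous_subtype_val

variable {G : Type v} [NormedAddCommGroup G] [NormedSpace ℝ G]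

/-- The data of a map `γ` on an open subset `B` of `ℝ^d` with values in `ℝ^J` together with a
`C^r`-map `ζ` defined on an open subset `P⁻¹(Ω)` of `ℝ^J`, where `P` takes values in a normed
space. -/
structure ShearData (r : ℕ∞) (d : ℕ) (J : Type u) (G : Type v) [NormedAddCommGroup G]
    [NormedSpace ℝ G] where
  B : Set (EuclideanSpace ℝ (Fin d))
  γ : EuclideanSpace ℝ (Fin d) → J → ℝ
  P : (J → ℝ) →L[ℝ] G
  Ω : Set G
  ζ : G → EuclideanSpace ℝ (Fin d)
  isOpen_B : IsOpen B
  isOpen_Ω : IsOpen Ω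
  contDiffOn_γ : ∀ j, ContDiffOn ℝ r (fun z => γ z j) B
  -- A continuous linear map from `ℝ^J` to a normed space depends on finitely many coordinates, so
  -- this follows from the previous field; stating it separately spares that argument.
  contDiffOn_Pγ : ContDiffOn ℝ r (fun z => P (γ z)) B
  contDiffOn_ζ : ContDiffOn ℝ r ζ Ω

namespace ShearData

variable {r : ℕ∞} (S : ShearData r d J G)

/-- The composite of the shears `(a, b) ↦ (a + ζ (P b), b)` and `(a, b) ↦ (a, b - γ a)`. -/
noncomputable def toFun (y : Fin d ⊕ J → ℝ) : Fin d ⊕ J → ℝ :=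
  joinCoord (eucProj d J y + S.ζ (S.P (coordProj d J y)))
    (coordProj d J y - S.γ (eucProj d J y + S.ζ (S.P (coordProj d J y))))

/-- The inverse of `ShearData.toFun`. -/
noncomputable def invFun (y : Fin d ⊕ J → ℝ) : Fin d ⊕ J → ℝ :=
  joinCoord (eucProj d J y - S.ζ (S.P (coordProj d J y + S.γ (eucProj d J y))))
    (coordProj d J y + S.γ (eucProj d J y))

def source : Set (Fin d ⊕ J → ℝ) :=
  {y | S.P (coordProj d J y) ∈ S.Ω ∧ eucProj d J y + S.ζ (S.P (coordProj d J y)) ∈ S.B}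

def target : Set (Fin d ⊕ J → ℝ) :=
  {y | eucProj d J y ∈ S.B ∧ S.P (coordProj d J y + S.γ (eucProj d J y)) ∈ S.Ω}

/-- The coordinates on which the components of the two shears depend. -/
noncomputable def factor (j : Fin d ⊕ J) :
    (Fin d ⊕ J → ℝ) →L[ℝ] (EuclideanSpace ℝ (Fin d) × G × ℝ) :=
  (eucProj d J).prod ((S.P.comp (coordProj d J)).prod (ContinuousLinearMap.proj j))

@[simp] theorem factor_apply (j : Fin d ⊕ J) (y : Fin d ⊕ J → ℝ) :
    S.factor j y = (eucProj d J y, S.P (coordProj d J y), y j) := rfl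

def factorSource : Set (EuclideanSpace ℝ (Fin d) × G × ℝ) :=
  {p | p.2.1 ∈ S.Ω ∧ p.1 + S.ζ p.2.1 ∈ S.B}

def factorTarget : Set (EuclideanSpace ℝ (Fin d) × G × ℝ) :=
  {p | p.1 ∈ S.B ∧ p.2.1 + S.P (S.γ p.1) ∈ S.Ω}

theorem contDiffOn_sum : ContDiffOn ℝ r (fun p : EuclideanSpace ℝ (Fin d) × G × ℝ =>
    p.1 + S.ζ p.2.1) {p | p.2.1 ∈ S.Ω} :=
  contDiff_fst.contDiffOn.add
    (S.contDiffOn_ζ.comp (contDiff_fst.comp contDiff_snd).contDiffOn fun _ hp => hp)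

theorem contDiffOn_sum' : ContDiffOn ℝ r (fun p : EuclideanSpace ℝ (Fin d) × G × ℝ =>
    p.2.1 + S.P (S.γ p.1)) {p | p.1 ∈ S.B} :=
  (contDiff_fst.comp contDiff_snd).contDiffOn.add
    (S.contDiffOn_Pγ.comp contDiff_fst.contDiffOn fun _ hp => hp)

theorem isOpen_factorSource : IsOpen S.factorSource :=
  S.contDiffOn_sum.continuousOn.isOpen_inter_preimage
    (S.isOpen_Ω.preimage (continuous_fst.comp continuous_snd)) S.isOpen_B

theorem isOpen_factorTarget : IsOpen S.factorTarget :=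
  S.contDiffOn_sum'.continuousOn.isOpen_inter_preimage
    (S.isOpen_B.preimage continuous_fst) S.isOpen_Ω

theorem source_eq (j : Fin d ⊕ J) : S.source = S.factor j ⁻¹' S.factorSource := rfl

theorem target_eq (j : Fin d ⊕ J) : S.target = S.factor j ⁻¹' S.factorTarget := by
  ext y; simp [target, factorTarget]

/-- Coordinate `j` depends on `y = (a, b)` only through `(a, P b, y j)`, a point of a normed space,
so Fréchet calculus applies coordinate by coordinate. -/
theorem mbContDiffOn_toFun : MBContDiffOn r S.toFun S.source := by
  refine .pi_of_factors (G := EuclideanSpace ℝ (Fin d) × G × ℝ) ?_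
  rintro (j | j)
  · refine ⟨S.factor (Sum.inl j), S.factorSource, fun p => (p.1 + S.ζ p.2.1) j,
      S.isOpen_factorSource, (S.source_eq _).subset, ?_, fun y _ => rfl⟩
    exact (EuclideanSpace.proj (𝕜 := ℝ) j).contDiff.comp_contDiffOn
      (S.contDiffOn_sum.mono fun p hp => hp.1)
  · refine ⟨S.factor (Sum.inr j), S.factorSource, fun p => p.2.2 - S.γ (p.1 + S.ζ p.2.1) j,
      S.isOpen_factorSource, (S.source_eq _).subset, ?_, fun y _ => rfl⟩
    exact (contDiff_snd.comp contDiff_snd).contDiffOn.sub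
      ((S.contDiffOn_γ j).comp (S.contDiffOn_sum.mono fun p hp => hp.1) fun p hp => hp.2)

theorem mbContDiffOn_invFun : MBContDiffOn r S.invFun S.target := by
  refine .pi_of_factors (G := EuclideanSpace ℝ (Fin d) × G × ℝ) ?_
  rintro (j | j)
  · refine ⟨S.factor (Sum.inl j), S.factorTarget, fun p => (p.1 - S.ζ (p.2.1 + S.P (S.γ p.1))) j,
      S.isOpen_factorTarget, (S.target_eq _).subset, ?_, fun y _ => by simp [invFun]⟩
    exact (EuclideanSpace.proj (𝕜 := ℝ) j).contDiff.comp_contDiffOn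
      (contDiff_fst.contDiffOn.sub (S.contDiffOn_ζ.comp
        (S.contDiffOn_sum'.mono fun p hp => hp.1) fun p hp => hp.2))
  · refine ⟨S.factor (Sum.inr j), S.factorTarget, fun p => p.2.2 + S.γ p.1 j,
      S.isOpen_factorTarget, (S.target_eq _).subset, ?_, fun y _ => rfl⟩
    exact (contDiff_snd.comp contDiff_snd).contDiffOn.add
      ((S.contDiffOn_γ j).comp contDiff_fst.contDiffOn fun p hp => hp.1)

/-- The composite of the two shears as a homeomorphism between open sets. -/
noncomputable def homeo : OpenPartialHomeomorph (Fin d ⊕ J → ℝ) (Fin d ⊕ J → ℝ) where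
  toFun := S.toFun
  invFun := S.invFun
  source := S.source
  target := S.target
  map_source' y hy := by simpa [toFun, target] using hy.symm
  map_target' y hy := by simpa [invFun, source] using hy.symm
  left_inv' y _ := by simp [toFun, invFun]
  right_inv' y _ := by simp [toFun, invFun]
  open_source := by
    -- `factor` needs an index, and `Fin d ⊕ J` may be empty. Its third component does not affect
    -- `factorSource`, so it is replaced by zero.
    have h : S.source = (eucProj d J).prod ((S.P.comp (coordProj d J)).prod 0) ⁻¹'
      S.factorSource := rfl
    exact h ▸ S.isOpen_factorSource.preimage (ContinuousLinearMap.continuous _)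
  open_target := by
    have h : S.target = (eucProj d J).prod ((S.P.comp (coordProj d J)).prod 0) ⁻¹'
      S.factorTarget := by ext y; simp [target, factorTarget]
    exact h ▸ S.isOpen_factorTarget.preimage (ContinuousLinearMap.continuous _)
  continuousOn_toFun := S.mbContDiffOn_toFun.continuousOn
  continuousOn_invFun := S.mbContDiffOn_invFun.continuousOn

theorem isMBDiffeo_homeo : IsMBDiffeo r S.homeo :=
  ⟨S.mbContDiffOn_toFun, S.mbContDiffOn_invFun⟩

end ShearData

end SliceCharts

/-! ### The embedding criterion -/

section EmbeddingCriterion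

variable {d : ℕ} {r : ℕ∞} {M : Type u} [TopologicalSpace M]
  [ChartedSpace (EuclideanSpace ℝ (Fin d)) M] {J : Type u}

theorem ContMDiff.contDiffOn_comp_chart_symm [IsManifold (𝓡 d) (r : WithTop ℕ∞) M] {G : Type*}
    [NormedAddCommGroup G] [NormedSpace ℝ G] {f : M → G} (hf : ContMDiff (𝓡 d) 𝓘(ℝ, G) r f)
    {ψ : OpenPartialHomeomorph M (EuclideanSpace ℝ (Fin d))}
    (hψ : ψ ∈ atlas (EuclideanSpace ℝ (Fin d)) M) :
    ContDiffOn ℝ r (fun z => f (ψ.symm z)) ψ.target :=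
  contMDiffOn_iff_contDiffOn.1 (hf.comp_contMDiffOn (contMDiffOn_symm_of_mem_maximalAtlas
    (IsManifold.subset_maximalAtlas hψ)))

/-- If near every point a chart of `M` is a `C^r`-function of finitely many of the coordinates
of `g`, then `(0, g)` is an embedding into `ℝ^d × ℝ^J`. -/
theorem isMBEmbedding_joinCoord [IsManifold (𝓡 d) (r : WithTop ℕ∞) M]
    {G : Type v} [NormedAddCommGroup G] [NormedSpace ℝ G] {g : M → J → ℝ}
    (hg : ∀ j, ContMDiff (𝓡 d) 𝓘(ℝ, ℝ) r fun x => g x j)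
    (h : ∀ x : M, ∃ (P : (J → ℝ) →L[ℝ] G) (Ω : Set G) (ζ : G → EuclideanSpace ℝ (Fin d)),
      IsOpen Ω ∧ ContDiffOn ℝ r ζ Ω ∧ ContMDiff (𝓡 d) 𝓘(ℝ, G) r (fun y => P (g y)) ∧
      P (g x) ∈ Ω ∧ ∀ y, P (g y) ∈ Ω → y ∈ (chartAt (EuclideanSpace ℝ (Fin d)) x).source ∧
        ζ (P (g y)) = chartAt (EuclideanSpace ℝ (Fin d)) x y) :
    IsMBEmbedding d r (fun x => joinCoord (0 : EuclideanSpace ℝ (Fin d)) (g x)) := by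
  have hfc : Continuous (fun x => joinCoord (0 : EuclideanSpace ℝ (Fin d)) (g x)) := by
    refine continuous_pi ?_
    rintro (j | j)
    · exact continuous_const
    · exact (hg j).continuous
  have hchart : ∀ x : M, ∃ φ : OpenPartialHomeomorph (Fin d ⊕ J → ℝ) (Fin d ⊕ J → ℝ),
      joinCoord 0 (g x) ∈ φ.source ∧
      IsSliceChart r (range fun x => joinCoord (0 : EuclideanSpace ℝ (Fin d)) (g x))
        (eucSubmodule d J) φ ∧
      (∀ y, joinCoord 0 (g y) ∈ φ.source → y ∈ (chartAt (EuclideanSpace ℝ (Fin d)) x).source ∧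
        φ (joinCoord 0 (g y)) = joinCoord (chartAt (EuclideanSpace ℝ (Fin d)) x y) 0) := by
    intro x
    obtain ⟨P, Ω, ζ, hΩ, hζ, hP, hx, hy⟩ := h x
    set ψ := chartAt (EuclideanSpace ℝ (Fin d)) x with hψ
    have hψa : ψ ∈ atlas (EuclideanSpace ℝ (Fin d)) M := chart_mem_atlas _ x
    let S : ShearData r d J G :=
      { B := ψ.target
        γ := fun z => g (ψ.symm z)
        P := P
        Ω := Ω
        ζ := ζ
        isOpen_B := ψ.open_target
        isOpen_Ω := hΩ
        contDiffOn_γ := fun j => (hg j).contDiffOn_comp_chart_symm hψa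
        contDiffOn_Pγ := hP.contDiffOn_comp_chart_symm hψa
        contDiffOn_ζ := hζ }
    have hsource : ∀ y, joinCoord 0 (g y) ∈ S.homeo.source ↔ P (g y) ∈ Ω := by
      intro y
      change (_ ∧ _) ↔ _
      simp only [eucProj_joinCoord, coordProj_joinCoord, zero_add]
      refine ⟨fun h => h.1, fun h => ⟨h, ?_⟩⟩
      rw [show S.ζ (S.P (g y)) = ψ y from (hy y h).2]
      exact ψ.map_source (hy y h).1
    have hval : ∀ y, P (g y) ∈ Ω → S.homeo (joinCoord 0 (g y)) = joinCoord (ψ y) 0 := by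
      intro y h
      change joinCoord _ _ = _
      simp only [eucProj_joinCoord, coordProj_joinCoord, zero_add]
      rw [show S.ζ (S.P (g y)) = ψ y from (hy y h).2,
        show S.γ (ψ y) = g y from congrArg g (ψ.left_inv (hy y h).1), sub_self]
    refine ⟨S.homeo, (hsource x).2 hx, ⟨S.isMBDiffeo_homeo, ?_⟩, fun y h =>
      ⟨(hy y ((hsource y).1 h)).1, hval y ((hsource y).1 h)⟩⟩
    ext w
    constructor
    · rintro ⟨_, ⟨h, y, rfl⟩, rfl⟩
      refine ⟨S.homeo.map_source h, ?_⟩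
      simp only [hval y ((hsource y).1 h)]
      simp [mem_eucSubmodule]
    -- A point `(z, 0)` of the target is the image of `(0, g (ψ⁻¹ z))`.
    · rintro ⟨⟨hw1, hw2⟩, hw⟩
      have hw0 : coordProj d J w = 0 := hw
      have hw2' : P (g (ψ.symm (eucProj d J w))) ∈ Ω := by
        have : S.P (coordProj d J w + S.γ (eucProj d J w)) ∈ Ω := hw2
        rwa [hw0, zero_add] at this
      refine ⟨joinCoord 0 (g (ψ.symm (eucProj d J w))), ⟨(hsource _).2 hw2', mem_range_self _⟩, ?_⟩
      rw [hval _ hw2', ψ.right_inv hw1, ← hw0, joinCoord_proj]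
  refine ⟨fun ψ hψ => ?_, eucSubmodule d J, ⟨isClosed_eucSubmodule, ?_⟩, ?_, fun x => ?_⟩
  · refine .pi_of_factors (G := EuclideanSpace ℝ (Fin d)) ?_
    rintro (j | j)
    · exact ⟨.id ℝ _, ψ.target, fun _ => 0, ψ.open_target, fun z hz => hz, contDiffOn_const,
        fun z _ => rfl⟩
    · exact ⟨.id ℝ _, ψ.target, fun z => g (ψ.symm z) j, ψ.open_target, fun z hz => hz,
        (hg j).contDiffOn_comp_chart_symm hψ, fun z _ => rfl⟩
  · rintro _ ⟨x, rfl⟩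
    obtain ⟨φ, h1, h2, -⟩ := hchart x
    exact ⟨φ, h1, h2⟩
  · refine ⟨isInducing_iff_nhds.2 fun x => le_antisymm (hfc.tendsto x).le_comap ?_, ?_⟩
    · obtain ⟨φ, hx, -, h3⟩ := hchart x
      set ψ := chartAt (EuclideanSpace ℝ (Fin d)) x with hψ
      -- `ψ⁻¹ ∘ eucProj ∘ φ` is a local left inverse of the map, continuous at the image of `x`;
      -- hence the neighbourhood filter of `x` is induced from the target.
      have hk : ContinuousAt (fun w => ψ.symm (eucProj d J (φ w))) (joinCoord 0 (g x)) := by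
        refine ContinuousAt.comp (g := ψ.symm) ?_
          ((eucProj d J).continuous.continuousAt.comp (φ.continuousAt hx))
        rw [(h3 x hx).2, eucProj_joinCoord]
        exact ψ.continuousAt_symm (ψ.map_source (h3 x hx).1)
      have hkf : ∀ y, joinCoord 0 (g y) ∈ φ.source →
          ψ.symm (eucProj d J (φ (joinCoord 0 (g y)))) = y := by
        intro y hy
        rw [(h3 y hy).2, eucProj_joinCoord, ψ.left_inv (h3 y hy).1]
      have ht := hk.tendsto.comp (tendsto_comap
        (f := fun x => joinCoord (0 : EuclideanSpace ℝ (Fin d)) (g x)))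
      rw [hkf x hx] at ht
      refine (tendsto_id'.1 (ht.congr' ?_))
      filter_upwards [preimage_mem_comap (φ.open_source.mem_nhds hx)] with y hy
      exact hkf y hy
    · intro x y hxy
      obtain ⟨φ, hx, -, h3⟩ := hchart x
      dsimp only at hxy
      have h1 := h3 x hx
      have h2 := h3 y (hxy ▸ hx)
      refine (chartAt (EuclideanSpace ℝ (Fin d)) x).injOn h1.1 h2.1 ?_
      have := h1.2.symm.trans ((congrArg φ hxy).trans h2.2)
      simpa using congrArg (eucProj d J) this
  · obtain ⟨φ, hx, hφ, h3⟩ := hchart x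
    refine ⟨φ, hx, hφ, ?_⟩
    set ψ := chartAt (EuclideanSpace ℝ (Fin d)) x with hψ
    have hopen : IsOpen (ψ.target ∩ ψ.symm ⁻¹'
        ((fun x => joinCoord (0 : EuclideanSpace ℝ (Fin d)) (g x)) ⁻¹' φ.source)) :=
      ψ.isOpen_inter_preimage_symm (φ.open_source.preimage hfc)
    -- In these charts the map is `a ↦ (a, 0)`, the restriction of a linear isomorphism.
    refine ⟨(eucEquiv d J).toHomeomorph.toOpenPartialHomeomorph.restrOpen _ hopen, ?_, ?_, ?_, ?_⟩
    · simp
    · intro z hz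
      have hz' : z ∈ ψ.target ∧ joinCoord 0 (g (ψ.symm z)) ∈ φ.source := by simpa using hz
      have := (h3 _ hz'.2).2
      dsimp only
      rw [this, ψ.right_inv hz'.1]
      rfl
    · exact .of_clm (eucEquiv d J : EuclideanSpace ℝ (Fin d) →L[ℝ] eucSubmodule d J) _
    · exact .of_clm ((eucEquiv d J).symm : eucSubmodule d J →L[ℝ] EuclideanSpace ℝ (Fin d)) _

end EmbeddingCriterion

/-! ### Embeddings from coloured families of charts -/

section ColouredCharts

variable {d : ℕ} {r : ℕ∞} {M : Type u} [TopologicalSpace M]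
  [ChartedSpace (EuclideanSpace ℝ (Fin d)) M]

theorem contDiffOn_chart_transition [IsManifold (𝓡 d) (r : WithTop ℕ∞) M] (p x : M) :
    ContDiffOn ℝ r
      (fun z => chartAt (EuclideanSpace ℝ (Fin d)) x
        ((chartAt (EuclideanSpace ℝ (Fin d)) p).symm z))
      ((chartAt (EuclideanSpace ℝ (Fin d)) p).symm.trans
        (chartAt (EuclideanSpace ℝ (Fin d)) x)).source := by
  refine contMDiffOn_iff_contDiffOn.1 ?_
  have h1 : ContMDiffOn (𝓡 d) (𝓡 d) r (chartAt (EuclideanSpace ℝ (Fin d)) p).symm _ :=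
    contMDiffOn_chart_symm
  have h2 : ContMDiffOn (𝓡 d) (𝓡 d) r (chartAt (EuclideanSpace ℝ (Fin d)) x) _ :=
    contMDiffOn_chart
  exact h2.comp (h1.mono fun z hz => by simp at hz; exact hz.1)
    fun z hz => by simp at hz; exact hz.2

/-- The projection of `ℝ^(C × ({0, 1} ⊔ {1, …, d}))` onto the coordinates with first
component `c`. -/
noncomputable def colourProj {C : Type u} (d : ℕ) (c : C) :
    (C × (Bool ⊕ Fin d) → ℝ) →L[ℝ] (ℝ × ℝ × EuclideanSpace ℝ (Fin d)) :=
  (ContinuousLinearMap.proj (c, Sum.inl true)).prod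
    ((ContinuousLinearMap.proj (c, Sum.inl false)).prod
      (((EuclideanSpace.equiv (Fin d) ℝ).symm : (Fin d → ℝ) →L[ℝ] EuclideanSpace ℝ (Fin d)).comp
        (ContinuousLinearMap.pi fun j => ContinuousLinearMap.proj (c, Sum.inr j))))

/-- Assume that for every point `x` of `M` there are a colour `c`, a label `n` and a chart `ψ` such
that `ξ c = ρ c • ψ` at all points where `ρ c` is positive and `h c / ρ c` is close to `n`. Then `M`
embeds into the real vector space with `d + (2 + d) |C|` coordinates. -/
theorem exists_isMBEmbedding_of_colouring [IsManifold (𝓡 d) (r : WithTop ℕ∞) M] {C : Type u}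
    {ρ h : C → M → ℝ} {ξ : C → M → EuclideanSpace ℝ (Fin d)}
    (hρ : ∀ c, ContMDiff (𝓡 d) 𝓘(ℝ, ℝ) r (ρ c)) (hh : ∀ c, ContMDiff (𝓡 d) 𝓘(ℝ, ℝ) r (h c))
    (hξ : ∀ c, ContMDiff (𝓡 d) (𝓡 d) r (ξ c))
    (hcov : ∀ x : M, ∃ (c : C) (n : ℝ) (p : M), 0 < ρ c x ∧ h c x = n * ρ c x ∧
      ∀ y, 0 < ρ c y → |h c y - n * ρ c y| < ρ c y / 2 →
        y ∈ (chartAt (EuclideanSpace ℝ (Fin d)) p).source ∧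
          ξ c y = ρ c y • chartAt (EuclideanSpace ℝ (Fin d)) p y) :
    ∃ f : M → (Fin d ⊕ C × (Bool ⊕ Fin d) → ℝ), IsMBEmbedding d r f := by
  let g : M → C × (Bool ⊕ Fin d) → ℝ := fun x j =>
    Sum.elim (fun b => if b then ρ j.1 x else h j.1 x) (fun i => ξ j.1 x i) j.2
  have hP : ∀ c y, colourProj d c (g y) = (ρ c y, h c y, ξ c y) := fun c y => rfl
  refine ⟨_, isMBEmbedding_joinCoord (g := g) (G := ℝ × ℝ × EuclideanSpace ℝ (Fin d)) ?_ ?_⟩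
  · rintro ⟨c, (b | i)⟩
    · cases b
      · exact hh c
      · exact hρ c
    · exact (EuclideanSpace.proj (𝕜 := ℝ) i).contDiff.contMDiff.comp (hξ c)
  · intro x
    obtain ⟨c, n, p, hx, hhx, hy⟩ := hcov x
    set ψ := chartAt (EuclideanSpace ℝ (Fin d)) p
    set χ := chartAt (EuclideanSpace ℝ (Fin d)) x
    have hquot : ∀ y, 0 < ρ c y → |h c y - n * ρ c y| < ρ c y / 2 →
        (ρ c y)⁻¹ • ξ c y = ψ y := fun y h1 h2 => by
      rw [(hy y h1 h2).2, smul_smul, inv_mul_cancel₀ h1.ne', one_smul]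
    have hx' : |h c x - n * ρ c x| < ρ c x / 2 := by
      rw [hhx, sub_self, abs_zero]; positivity
    let Ω₀ : Set (ℝ × ℝ × EuclideanSpace ℝ (Fin d)) := {q | 0 < q.1 ∧ |q.2.1 - n * q.1| < q.1 / 2}
    have hΩ₀ : IsOpen Ω₀ :=
      (isOpen_lt (by fun_prop : Continuous fun _ : ℝ × ℝ × EuclideanSpace ℝ (Fin d) => (0 : ℝ))
        (by fun_prop : Continuous fun q : ℝ × ℝ × EuclideanSpace ℝ (Fin d) => q.1)).inter
      (isOpen_lt (by fun_prop :
          Continuous fun q : ℝ × ℝ × EuclideanSpace ℝ (Fin d) => |q.2.1 - n * q.1|)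
        (by fun_prop : Continuous fun q : ℝ × ℝ × EuclideanSpace ℝ (Fin d) => q.1 / 2))
    have hq : ContDiffOn ℝ r (fun q : ℝ × ℝ × EuclideanSpace ℝ (Fin d) => q.1⁻¹ • q.2.2) Ω₀ :=
      (contDiff_fst.contDiffOn.inv fun q hq => hq.1.ne').smul
        (contDiff_snd.comp contDiff_snd).contDiffOn
    -- The quotient `ξ / ρ` gives the chart `ψ` at `p`, whereas the criterion asks for the chart `χ`
    -- at `x`; so `ζ` is followed by the transition map and `Ω₀` is cut down to its domain.
    refine ⟨colourProj d c, Ω₀ ∩ (fun q => q.1⁻¹ • q.2.2) ⁻¹' (ψ.symm.trans χ).source,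
      fun q => χ (ψ.symm (q.1⁻¹ • q.2.2)), hq.continuousOn.isOpen_inter_preimage hΩ₀
        (ψ.symm.trans χ).open_source, ?_, ?_, ?_, ?_⟩
    · exact (contDiffOn_chart_transition p x).comp (hq.mono inter_subset_left) fun q hq => hq.2
    · simp only [hP]
      exact (hρ c).prodMk_space ((hh c).prodMk_space (hξ c))
    · rw [hP]
      refine ⟨⟨hx, hx'⟩, ?_⟩
      have hs := (hy x hx hx').1
      simp only [mem_preimage, hquot x hx hx', OpenPartialHomeomorph.trans_source,
        OpenPartialHomeomorph.symm_source, mem_inter_iff, ψ.left_inv hs]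
      exact ⟨ψ.map_source hs, mem_chart_source _ x⟩
    · intro y hyΩ
      rw [hP] at hyΩ ⊢
      obtain ⟨⟨h1, h2⟩, h3⟩ := hyΩ
      have hs := (hy y h1 h2).1
      simp only [mem_preimage, hquot y h1 h2, OpenPartialHomeomorph.trans_source,
        OpenPartialHomeomorph.symm_source, mem_inter_iff, ψ.left_inv hs] at h3 ⊢
      exact ⟨h3.2, trivial⟩

end ColouredCharts

/-! ### Functions supported in one chart -/

section ChartSupportedFunctions

variable {d : ℕ} {r : ℕ∞} {M : Type u} [TopologicalSpace M]
  [ChartedSpace (EuclideanSpace ℝ (Fin d)) M]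

theorem contMDiff_of_eqOn_chart [IsManifold (𝓡 d) (r : WithTop ℕ∞) M] {V : Type*}
    [NormedAddCommGroup V] [NormedSpace ℝ V] {p : M} {k : M → V}
    {K : EuclideanSpace ℝ (Fin d) → V} (hK : ContDiff ℝ r K)
    (hk : EqOn k (K ∘ chartAt (EuclideanSpace ℝ (Fin d)) p)
      (chartAt (EuclideanSpace ℝ (Fin d)) p).source)
    (hs : tsupport k ⊆ (chartAt (EuclideanSpace ℝ (Fin d)) p).source) :
    ContMDiff (𝓡 d) 𝓘(ℝ, V) r k := by
  refine contMDiff_of_tsupport fun x hx => ?_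
  have hxs := (chartAt (EuclideanSpace ℝ (Fin d)) p).open_source.mem_nhds (hs hx)
  have h : ContMDiffOn (𝓡 d) (𝓡 d) r (chartAt (EuclideanSpace ℝ (Fin d)) p) _ :=
    contMDiffOn_chart
  exact (hK.contMDiff.contMDiffAt.comp x (h.contMDiffAt hxs)).congr_of_eventuallyEq
    (hk.eventuallyEq_of_mem hxs)

/-- Every open subset of `ℝ^d` is the support of a nonnegative smooth function. Pull one back from
the image of `O`; since the closure of `O` stays in the chart domain, extension by zero is `C^r`. -/
theorem exists_contMDiff_support_eq_of_closure_subset_chart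
    [IsManifold (𝓡 d) (r : WithTop ℕ∞) M] {p : M} {O : Set M} (hO : IsOpen O)
    (hcl : closure O ⊆ (chartAt (EuclideanSpace ℝ (Fin d)) p).source) :
    ∃ (ρ : M → ℝ) (ξ : M → EuclideanSpace ℝ (Fin d)),
      ContMDiff (𝓡 d) 𝓘(ℝ, ℝ) r ρ ∧ ContMDiff (𝓡 d) (𝓡 d) r ξ ∧ (∀ y, 0 ≤ ρ y) ∧
      Function.support ρ = O ∧ Function.support ξ ⊆ O ∧
      ∀ y ∈ O, ξ y = ρ y • chartAt (EuclideanSpace ℝ (Fin d)) p y := by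
  classical
  set ψ := chartAt (EuclideanSpace ℝ (Fin d)) p
  have hOs : O ⊆ ψ.source := subset_closure.trans hcl
  obtain ⟨G, hG, hGs, hGr⟩ := (ψ.isOpen_image_of_subset_source hO hOs).exists_contDiff_support_eq
    (n := (r : ℕ∞))
  have hG0 : ∀ y ∈ ψ.source, y ∉ O → G (ψ y) = 0 := by
    intro y hy hyO
    by_contra hne
    have : ψ y ∈ ψ '' O := hG ▸ hne
    obtain ⟨z, hz, hzy⟩ := this
    exact hyO (ψ.injOn (hOs hz) hy hzy ▸ hz)
  have hG1 : ∀ y ∈ O, G (ψ y) ≠ 0 := fun y hy => by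
    have : ψ y ∈ Function.support G := hG ▸ mem_image_of_mem ψ hy
    exact this
  refine ⟨O.indicator (G ∘ ψ), O.indicator (fun y => G (ψ y) • ψ y), ?_, ?_, ?_, ?_,
    Set.support_indicator_subset, ?_⟩
  · refine contMDiff_of_eqOn_chart hGs (p := p) (fun y hy => ?_)
      ((closure_mono Set.support_indicator_subset).trans hcl)
    by_cases hyO : y ∈ O
    · simp [hyO, ψ]
    · simp [hyO, hG0 y hy hyO, ψ]
  · refine contMDiff_of_eqOn_chart (hGs.smul contDiff_id) (p := p) (fun y hy => ?_)
      ((closure_mono Set.support_indicator_subset).trans hcl)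
    by_cases hyO : y ∈ O
    · simp [hyO, ψ]
    · simp [hyO, hG0 y hy hyO, ψ]
  · exact fun y => Set.indicator_nonneg (fun z _ => (hGr (mem_range_self _)).1) y
  · ext y
    by_cases hyO : y ∈ O <;> simp [hyO, hG1]
  · intro y hy
    simp [hy]

/-- Every Hausdorff manifold embeds into a power of the real line, with `2 + d` coordinates for
every point of the manifold and `d` additional coordinates. -/
theorem exists_isMBEmbedding_of_points [T2Space M] [IsManifold (𝓡 d) (r : WithTop ℕ∞) M] :
    ∃ f : M → (Fin d ⊕ M × (Bool ⊕ Fin d) → ℝ), IsMBEmbedding d r f := by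
  have key : ∀ x : M, ∃ (ρ : M → ℝ) (ξ : M → EuclideanSpace ℝ (Fin d)),
      ContMDiff (𝓡 d) 𝓘(ℝ, ℝ) r ρ ∧ ContMDiff (𝓡 d) (𝓡 d) r ξ ∧ 0 < ρ x ∧
      ∀ y, 0 < ρ y → y ∈ (chartAt (EuclideanSpace ℝ (Fin d)) x).source ∧
        ξ y = ρ y • chartAt (EuclideanSpace ℝ (Fin d)) x y := by
    intro x
    let b : SmoothBumpFunction (𝓡 d) x := Classical.arbitrary _
    obtain ⟨ρ, ξ, h1, h2, h3, h4, -, h6⟩ := exists_contMDiff_support_eq_of_closure_subset_chart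
      (r := r) (p := x) b.isOpen_support b.tsupport_subset_chartAt_source
    refine ⟨ρ, ξ, h1, h2, (h3 x).lt_of_ne' ?_, fun y hy => ?_⟩
    · have : x ∈ Function.support ρ := h4 ▸ b.c_mem_support
      exact this
    · have hy' : y ∈ Function.support b := h4 ▸ (show y ∈ Function.support ρ from hy.ne')
      exact ⟨b.support_subset_source hy', h6 y hy'⟩
  choose ρ ξ h1 h2 h3 h4 using key
  -- Each point is its own colour, with a single chart; the label `0` carries no information.
  exact exists_isMBEmbedding_of_colouring h1 (h := fun _ _ => 0) (fun _ => contMDiff_const) h2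
    fun x => ⟨x, 0, x, h3 x, by simp, fun y hy _ => h4 x y hy⟩

end ChartSupportedFunctions

/-! ### Levels in general position -/

section GenericLevels

variable {d : ℕ} {r : ℕ∞} {M : Type u} [TopologicalSpace M]
  [ChartedSpace (EuclideanSpace ℝ (Fin d)) M]

/-- Countably many charts cover `M`, and in each the map is `C^1`, hence locally Lipschitz and
unable to raise Hausdorff dimension. -/
theorem ContMDiff.dimH_range_le_of_secondCountable [SecondCountableTopology M]
    [IsManifold (𝓡 d) (r : WithTop ℕ∞) M] (hr : 1 ≤ r) {G : Type*} [NormedAddCommGroup G]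
    [NormedSpace ℝ G] {k : M → G} (hk : ContMDiff (𝓡 d) 𝓘(ℝ, G) r k) :
    dimH (range k) ≤ d := by
  obtain ⟨s, hs, hcov⟩ := TopologicalSpace.countable_cover_nhds
    (fun x : M => chart_source_mem_nhds (EuclideanSpace ℝ (Fin d)) x)
  have hsub : range k ⊆ ⋃ p ∈ s, (fun z => k ((chartAt (EuclideanSpace ℝ (Fin d)) p).symm z)) ''
      (chartAt (EuclideanSpace ℝ (Fin d)) p).target := by
    rintro _ ⟨x, rfl⟩
    have hx : x ∈ ⋃ p ∈ s, (chartAt (EuclideanSpace ℝ (Fin d)) p).source := hcov ▸ mem_univ x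
    simp only [mem_iUnion] at hx ⊢
    obtain ⟨p, hp, hxp⟩ := hx
    exact ⟨p, hp, _, (chartAt _ p).map_source hxp, by simp only [(chartAt _ p).left_inv hxp]⟩
  refine (dimH_mono hsub).trans ?_
  rw [dimH_bUnion hs]
  refine iSup₂_le fun p _ => ?_
  have hc := hk.contDiffOn_comp_chart_symm (chart_mem_atlas (EuclideanSpace ℝ (Fin d)) p)
  refine (dimH_image_le_of_locally_lipschitzOn fun z hz => ?_).trans
    ((dimH_mono (subset_univ _)).trans (by simp [Real.dimH_univ_eq_finrank]))
  obtain ⟨C, t, ht, hL⟩ := ((hc.contDiffAt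
    ((chartAt _ p).open_target.mem_nhds hz)).of_le (by exact_mod_cast hr)).exists_lipschitzOnWith
  exact ⟨C, t, mem_nhdsWithin_of_mem_nhds ht, hL⟩

open MeasureTheory in
/-- For countably many `C^r`-functions on a `d`-dimensional manifold there are levels such that
no point lies on `d + 1` of the level sets. -/
theorem exists_generic_levels [SecondCountableTopology M] [IsManifold (𝓡 d) (r : WithTop ℕ∞) M]
    (hr : 1 ≤ r) {ι : Type*} [Countable ι] {w : ι → M → ℝ}
    (hw : ∀ i, ContMDiff (𝓡 d) 𝓘(ℝ, ℝ) r (w i)) :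
    ∃ t : ι → ℝ, (∀ i, t i ∈ Icc (1 : ℝ) 2) ∧
      ∀ (x : M) (S : Finset ι), (∀ i ∈ S, w i x = t i) → S.card ≤ d := by
  -- The levels are chosen independently and uniformly in `[1, 2]`. For `d + 1` indices the joint
  -- image of `M` has dimension at most `d`, hence is null in `ℝ^(d+1)`; there are only countably
  -- many finite index sets.
  let μ : Measure ℝ := volume.restrict (Icc 1 2)
  have : IsProbabilityMeasure μ := ⟨by simp [μ]; norm_num⟩
  let Q : Measure (ι → ℝ) := Measure.infinitePi fun _ => μ
  have h1 : ∀ᵐ t ∂Q, ∀ i, t i ∈ Icc (1 : ℝ) 2 := by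
    refine ae_all_iff.2 fun i => ?_
    exact (measurePreserving_eval_infinitePi (fun _ : ι => μ) i).quasiMeasurePreserving.ae
      (ae_restrict_mem measurableSet_Icc)
  have h2 : ∀ᵐ t ∂Q, ∀ S : Finset ι, S.card = d + 1 →
      (fun i : S => t i) ∉ range fun (x : M) (i : S) => w i x := by
    refine ae_all_iff.2 fun S => ?_
    by_cases hS : S.card = d + 1
    swap
    · simp [hS]
    have hk : ContMDiff (𝓡 d) 𝓘(ℝ, S → ℝ) r fun (x : M) (i : S) => w i x :=
      contMDiff_pi_space.2 fun i => hw i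
    have hdim : dimH (range fun (x : M) (i : S) => w i x) < ((d + 1 : ℕ) : NNReal) :=
      (hk.dimH_range_le_of_secondCountable hr).trans_lt (by exact_mod_cast Nat.lt_succ_self d)
    have hvol : volume (range fun (x : M) (i : S) => w i x) = 0 := by
      rw [← hausdorffMeasure_pi_real]
      have := hausdorffMeasure_of_dimH_lt hdim
      simpa [hS] using this
    have hpi : Measure.pi (fun _ : S => μ) (range fun (x : M) (i : S) => w i x) = 0 := by
      have : Measure.pi (fun _ : S => μ) = volume.restrict (univ.pi fun _ => Icc 1 2) :=
        (Measure.restrict_pi_pi _ _).symm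
      rw [this]
      exact Measure.restrict_le_self.absolutelyContinuous hvol
    have hmp : MeasurePreserving (fun (t : ι → ℝ) (i : S) => t i) Q (Measure.pi fun _ : S => μ) :=
      ⟨S.measurable_restrict, Measure.infinitePi_map_restrict _⟩
    filter_upwards [hmp.quasiMeasurePreserving.ae (measure_eq_zero_iff_ae_notMem.1 hpi)] with t ht _
    exact ht
  obtain ⟨t, ht1, ht2⟩ := (h1.and h2).exists
  refine ⟨t, ht1, fun x S hS => ?_⟩
  by_contra! hlt
  obtain ⟨T, hTS, hT⟩ := Finset.exists_subset_card_eq (Nat.succ_le_of_lt hlt)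
  exact ht2 T hT ⟨x, funext fun i => hS i (hTS i.2)⟩

end GenericLevels

/-! ### Decomposition into cells by generic levels -/

section Cells

variable {X ι : Type*}

/-- The points at which the differences `|w i - t i|` with `i ∈ S` are smaller than `1` and than
all other ones, and at which `T` is the set of the indices `i ∉ S` with `w i > t i`, the functions
with the remaining indices being smaller than their levels. -/
def levelCell (w : ι → X → ℝ) (t : ι → ℝ) (q : Finset ι × Finset ι) : Set X :=
  {x | (∀ i ∈ q.1, |w i x - t i| < 1 ∧ ∀ j ∉ q.1, |w i x - t i| < |w j x - t j|) ∧
    (∀ i ∈ q.2, i ∉ q.1 ∧ t i < w i x) ∧ ∀ j ∉ q.1, j ∉ q.2 → w j x < t j}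

variable {w : ι → X → ℝ} {t : ι → ℝ}

theorem levelCell_subset_support (ht : ∀ i, 1 ≤ t i) {q : Finset ι × Finset ι} {i : ι}
    (hi : i ∈ q.1 ∨ i ∈ q.2) : levelCell w t q ⊆ Function.support (w i) := by
  rintro x ⟨h1, h2, -⟩ h0
  rcases hi with hi | hi
  · have := (abs_lt.1 (h1 i hi).1).1
    linarith [ht i]
  · linarith [(h2 i hi).2, ht i]

theorem levelCell_empty (h : ∀ x, ∃ i, t i < w i x) : levelCell w t (∅, ∅) = ∅ := by
  refine eq_empty_of_forall_notMem fun x hx => ?_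
  obtain ⟨i, hi⟩ := h x
  exact lt_asymm hi (hx.2.2 i (by simp) (by simp))

/-- If the first sets had equal size but differed, each would contain an index missing from the
other, and each of the two differences `|w - t|` would be smaller than the other. Once the first
sets agree, the second set is determined by the signs of `w i x - t i`. -/
theorem eq_of_mem_levelCell {x : X} {q q' : Finset ι × Finset ι} (hc : q.1.card = q'.1.card)
    (hx : x ∈ levelCell w t q) (hx' : x ∈ levelCell w t q') : q = q' := by
  have h1 : q.1 = q'.1 := by
    refine Finset.eq_of_subset_of_card_le (fun i hi => ?_) hc.ge
    by_contra hi'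
    have : ¬ q'.1 ⊆ q.1 := fun hsub =>
      hi' (Finset.eq_of_subset_of_card_le hsub hc.le ▸ hi)
    obtain ⟨j, hj', hj⟩ := Finset.not_subset.1 this
    exact lt_asymm ((hx.1 i hi).2 j hj) ((hx'.1 j hj').2 i hi')
  have aux : ∀ {q q' : Finset ι × Finset ι}, q.1 = q'.1 → x ∈ levelCell w t q →
      x ∈ levelCell w t q' → q.2 ⊆ q'.2 := by
    intro q q' h hx hx' i hi
    by_contra hi'
    exact lt_asymm (hx.2.1 i hi).2 (hx'.2.2 i (h ▸ (hx.2.1 i hi).1) hi')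
  exact Prod.ext h1 ((aux h1 hx hx').antisymm (aux h1.symm hx' hx))

variable [TopologicalSpace X]

/-- Both index sets of a cell consist of functions that are nonzero on it, so near a point only
finitely many pairs can occur. -/
theorem locallyFinite_levelCell (ht : ∀ i, 1 ≤ t i)
    (hlf : LocallyFinite fun i => Function.support (w i)) : LocallyFinite (levelCell w t) := by
  intro x
  obtain ⟨N, hN, hfin⟩ := hlf x
  refine ⟨N, hN, ((hfin.toFinset.powerset ×ˢ hfin.toFinset.powerset).finite_toSet).subset ?_⟩
  rintro q ⟨y, hy, hyN⟩
  simp only [Finset.coe_product, Finset.coe_powerset, mem_prod, mem_preimage, mem_powerset_iff,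
    Finset.coe_subset]
  constructor <;> intro i hi <;> simp only [Finite.mem_toFinset, mem_ofPred_eq]
  · exact ⟨y, levelCell_subset_support ht (Or.inl hi) hy, hyN⟩
  · exact ⟨y, levelCell_subset_support ht (Or.inr hi) hy, hyN⟩

theorem isOpen_levelCell (ht : ∀ i, 1 ≤ t i) (hw : ∀ i, Continuous (w i))
    (hlf : LocallyFinite fun i => Function.support (w i)) (q : Finset ι × Finset ι) :
    IsOpen (levelCell w t q) := by
  have hlf' : LocallyFinite fun i => tsupport (w i) := hlf.closure
  have hmem : ∀ j x, w j x ≠ 0 → x ∈ tsupport (w j) := fun j x h => subset_tsupport _ h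
  have hA : ∀ i, IsOpen {x | |w i x - t i| < 1 ∧ ∀ j ∉ q.1, |w i x - t i| < |w j x - t j|} := by
    intro i
    -- Intersecting with the supports makes the union of violations locally finite, hence closed.
    -- Nothing is lost: where `w j` vanishes, `|w j - t j| = t j ≥ 1`, which already exceeds `|w i -
    -- t i|`. This is the role of the bound `1` in `levelCell`.
    have hcl : IsClosed (⋃ j : {j // j ∉ q.1},
        {x | |w j x - t j| ≤ |w i x - t i|} ∩ tsupport (w j)) := by
      refine LocallyFinite.isClosed_iUnion ?_ fun j => ?_
      · exact (hlf'.comp_injective Subtype.val_injective).subset fun j => inter_subset_right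
      · exact (isClosed_le (((hw j).sub continuous_const).abs)
          (((hw i).sub continuous_const).abs)).inter (isClosed_tsupport _)
    have heq : {x | |w i x - t i| < 1 ∧ ∀ j ∉ q.1, |w i x - t i| < |w j x - t j|} =
        {x | |w i x - t i| < 1} ∩ (⋃ j : {j // j ∉ q.1},
          {x | |w j x - t j| ≤ |w i x - t i|} ∩ tsupport (w j))ᶜ := by
      ext x
      simp only [mem_ofPred_eq, mem_inter_iff, mem_compl_iff, mem_iUnion, not_exists, not_and,
        Subtype.forall]
      refine and_congr_right fun h => forall₂_congr fun j hj =>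
        ⟨fun h1 h2 => absurd h1 h2.not_gt, fun h1 => ?_⟩
      by_contra! h2
      refine h1 h2 (hmem j x fun h0 => ?_)
      rw [h0, zero_sub, abs_neg, abs_of_pos (by linarith [ht j])] at h2
      linarith [ht j]
    rw [heq]
    exact (isOpen_lt (((hw i).sub continuous_const).abs) continuous_const).inter hcl.isOpen_compl
  have hB : IsOpen {x | ∀ i ∈ q.2, i ∉ q.1 ∧ t i < w i x} := by
    simp only [ofPred_forall]
    exact isOpen_biInter_finset fun i _ =>
      isOpen_const.inter (isOpen_lt continuous_const (hw i))
  have hC : IsOpen {x | ∀ j ∉ q.1, j ∉ q.2 → w j x < t j} := by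
    have hcl : IsClosed (⋃ j : {j // j ∉ q.1 ∧ j ∉ q.2}, {x | t j ≤ w j x}) := by
      refine LocallyFinite.isClosed_iUnion ?_ fun j => isClosed_le continuous_const (hw j)
      refine (hlf.comp_injective
        (Subtype.val_injective (p := fun j => j ∉ q.1 ∧ j ∉ q.2))).subset fun j x hx h0 => ?_
      simp only [mem_ofPred_eq] at hx
      rw [h0] at hx
      linarith [ht j]
    convert hcl.isOpen_compl using 1
    ext x
    simp only [mem_ofPred_eq, mem_compl_iff, mem_iUnion, not_exists, not_le, Subtype.forall,
      and_imp]
  have hA' : IsOpen {x | ∀ i ∈ q.1,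
      |w i x - t i| < 1 ∧ ∀ j ∉ q.1, |w i x - t i| < |w j x - t j|} := by
    simp only [ofPred_forall]
    exact isOpen_biInter_finset fun i _ => hA i
  exact hA'.inter (hB.inter hC)

/-- Take the indices exactly at their level and those strictly above it. Genericity bounds the
number of the former by `d`. -/
theorem exists_mem_levelCell {d : ℕ} (ht : ∀ i, 1 ≤ t i)
    (hlf : LocallyFinite fun i => Function.support (w i))
    (hgen : ∀ (x : X) (S : Finset ι), (∀ i ∈ S, w i x = t i) → S.card ≤ d) (x : X) :
    ∃ q : Finset ι × Finset ι, q.1.card ≤ d ∧ x ∈ levelCell w t q := by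
  have hfin : {i | w i x ≠ 0}.Finite := hlf.point_finite x
  have hS : {i | w i x = t i}.Finite := hfin.subset fun i hi h0 => by
    simp only [mem_ofPred_eq] at hi
    linarith [ht i]
  have hT : {i | t i < w i x}.Finite := hfin.subset fun i hi h0 => by
    simp only [mem_ofPred_eq] at hi
    linarith [ht i]
  refine ⟨(hS.toFinset, hT.toFinset), hgen x _ fun i hi => by simpa using hi, ?_, ?_, ?_⟩
  · intro i hi
    have hi' : w i x = t i := by simpa using hi
    simp only [hi', sub_self, abs_zero, zero_lt_one, true_and]
    intro j hj
    have hj' : w j x ≠ t j := by simpa using hj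
    exact abs_pos.2 (sub_ne_zero.2 hj')
  · intro i hi
    have hi' : t i < w i x := by simpa using hi
    exact ⟨by simpa using hi'.ne', hi'⟩
  · intro j hj hj'
    have h1 : w j x ≠ t j := by simpa using hj
    have h2 : w j x ≤ t j := by simpa using hj'
    exact h2.lt_of_ne h1

end Cells

/-! ### Finite-dimensional embeddings in the second countable case -/

section SecondCountable

variable {d : ℕ} {r : ℕ∞} {M : Type u} [TopologicalSpace M]
  [ChartedSpace (EuclideanSpace ℝ (Fin d)) M]

/-- The atlas is only `C^r`, so a bump function that is smooth in its own chart is only `C^r` on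
`M`. -/
theorem SmoothBumpFunction.contMDiff_of_isManifold [T2Space M]
    [IsManifold (𝓡 d) (r : WithTop ℕ∞) M] {p : M} (b : SmoothBumpFunction (𝓡 d) p) :
    ContMDiff (𝓡 d) 𝓘(ℝ, ℝ) r b :=
  contMDiff_of_eqOn_chart (p := p) b.toContDiffBump.contDiff b.eqOn_source
    b.tsupport_subset_chartAt_source

theorem finsum_eq_of_mem {Q V X : Type*} [AddCommMonoid V] {cell : Q → Set X}
    (hdisj : ∀ x q q', x ∈ cell q → x ∈ cell q' → q = q') {k : Q → X → V}
    (hk : ∀ q, Function.support (k q) ⊆ cell q) {x : X} {q : Q} (hx : x ∈ cell q) :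
    ∑ᶠ q', k q' x = k q x :=
  finsum_eq_single _ q fun q' hq' => by
    by_contra h
    exact hq' (hdisj x q' q (hk q' h) hx)

/-- A second countable Hausdorff manifold of dimension `d` embeds into a space of dimension
`d + (d + 1) (d + 2)`. -/
theorem exists_isMBEmbedding_of_secondCountable [T2Space M] [SecondCountableTopology M]
    [IsManifold (𝓡 d) (r : WithTop ℕ∞) M] (hr : 1 ≤ r) :
    ∃ f : M → (Fin d ⊕ ULift.{u} (Fin (d + 1)) × (Bool ⊕ Fin d) → ℝ), IsMBEmbedding d r f := by
  have : LocallyCompactSpace M := ChartedSpace.locallyCompactSpace (EuclideanSpace ℝ (Fin d)) M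
  obtain ⟨ι, fs, -⟩ := SmoothBumpCovering.exists_isSubordinate (𝓡 d) (isClosed_univ (X := M))
    (U := fun _ => univ) fun _ _ => univ_mem
  have : Countable ι := countable_univ_iff.1
    (fs.locallyFinite.countable_univ fun i => (fs i).nonempty_support)
  -- Some bump function equals `1` at any given point; the factor `3` lifts it above every level in
  -- `[1, 2]`.
  let w : ι → M → ℝ := fun i x => 3 * fs i x
  have hsupp : ∀ i, Function.support (w i) = Function.support (fs i) := fun i => by
    ext x; simp [w]
  have hw : ∀ i, ContMDiff (𝓡 d) 𝓘(ℝ, ℝ) r (w i) := fun i =>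
    contMDiff_const.mul (fs i).contMDiff_of_isManifold
  have hlf : LocallyFinite fun i => Function.support (w i) := by
    simpa only [hsupp] using fs.locallyFinite
  obtain ⟨t, ht, hgen⟩ := exists_generic_levels hr hw
  have ht1 : ∀ i, 1 ≤ t i := fun i => (ht i).1
  have hcov : ∀ x, ∃ i, t i < w i x := fun x => by
    obtain ⟨i, hi⟩ := fs.eventuallyEq_one' x (mem_univ x)
    refine ⟨i, ?_⟩
    have : fs i x = 1 := hi.self_of_nhds
    simp only [w, this]
    linarith [(ht i).2]
  have hopen := isOpen_levelCell ht1 (fun i => (hw i).continuous) hlf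
  have key : ∀ q : Finset ι × Finset ι, ∃ (ρ : M → ℝ) (ξ : M → EuclideanSpace ℝ (Fin d)),
      ContMDiff (𝓡 d) 𝓘(ℝ, ℝ) r ρ ∧ ContMDiff (𝓡 d) (𝓡 d) r ξ ∧ (∀ y, 0 ≤ ρ y) ∧
      Function.support ρ = levelCell w t q ∧ Function.support ξ ⊆ levelCell w t q ∧
      ((levelCell w t q).Nonempty → ∃ p, ∀ y ∈ levelCell w t q,
        y ∈ (chartAt (EuclideanSpace ℝ (Fin d)) p).source ∧
        ξ y = ρ y • chartAt (EuclideanSpace ℝ (Fin d)) p y) := by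
    intro q
    by_cases hq : ∃ i, i ∈ q.1 ∨ i ∈ q.2
    · obtain ⟨i, hi⟩ := hq
      have hsub : levelCell w t q ⊆ Function.support (fs i) :=
        hsupp i ▸ levelCell_subset_support ht1 hi
      obtain ⟨ρ, ξ, h1, h2, h3, h4, h5, h6⟩ :=
        exists_contMDiff_support_eq_of_closure_subset_chart (r := r) (hopen q)
          ((closure_mono hsub).trans (fs i).tsupport_subset_chartAt_source)
      exact ⟨ρ, ξ, h1, h2, h3, h4, h5, fun _ => ⟨_, fun y hy =>
        ⟨(fs i).support_subset_source (hsub hy), h6 y hy⟩⟩⟩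
    -- The pair `(∅, ∅)` singles out no chart, but its cell is empty because every point lies above
    -- some level.
    · push Not at hq
      have hq' : q = (∅, ∅) := Prod.ext (Finset.eq_empty_of_forall_notMem fun i => (hq i).1)
        (Finset.eq_empty_of_forall_notMem fun i => (hq i).2)
      have hemp : levelCell w t q = ∅ := hq' ▸ levelCell_empty hcov
      rw [hemp]
      exact ⟨fun _ => 0, fun _ => 0, contMDiff_const, contMDiff_const, fun _ => le_rfl,
        Function.support_zero, by simp, fun h => absurd h (by simp)⟩
  choose ρ ξ hρ hξ hρ0 hρs hξs hchart using key
  -- Cells get distinct integer labels, so a label known to within `1/2` determines the cell. The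
  -- colour of a cell is the size of its first index set.
  obtain ⟨ν, hν⟩ := exists_injective_nat (Finset ι × Finset ι)
  let Q : ULift.{u} (Fin (d + 1)) → Type u := fun c =>
    {q : Finset ι × Finset ι // q.1.card = c.down}
  have hlfc : LocallyFinite (levelCell w t) := locallyFinite_levelCell ht1 hlf
  have hdisj : ∀ c x (q q' : Q c), x ∈ levelCell w t q.1 → x ∈ levelCell w t q'.1 → q = q' :=
    fun c x q q' hx hx' => Subtype.ext (eq_of_mem_levelCell (q.2.trans q'.2.symm) hx hx')
  have hsmooth : ∀ {V : Type} [NormedAddCommGroup V] [NormedSpace ℝ V]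
      (k : Finset ι × Finset ι → M → V), (∀ q, ContMDiff (𝓡 d) 𝓘(ℝ, V) r (k q)) →
      (∀ q, Function.support (k q) ⊆ levelCell w t q) →
      ∀ c, ContMDiff (𝓡 d) 𝓘(ℝ, V) r fun y => ∑ᶠ q : Q c, k q.1 y := by
    intro V _ _ k hk hks c
    exact contMDiff_finsum (fun q => hk q.1)
      ((hlfc.comp_injective Subtype.val_injective).subset fun q => hks q.1)
  have hks : ∀ q, Function.support (fun y => (ν q : ℝ) * ρ q y) ⊆ levelCell w t q := fun q y hy =>
    hρs q ▸ (show ρ q y ≠ 0 from right_ne_zero_of_mul hy)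
  refine exists_isMBEmbedding_of_colouring (C := ULift.{u} (Fin (d + 1)))
    (ρ := fun c y => ∑ᶠ q : Q c, ρ q.1 y) (h := fun c y => ∑ᶠ q : Q c, (ν q.1 : ℝ) * ρ q.1 y)
    (ξ := fun c y => ∑ᶠ q : Q c, ξ q.1 y) (hsmooth ρ hρ fun q => (hρs q).subset)
    (hsmooth (fun q y => (ν q : ℝ) * ρ q y) (fun q => contMDiff_const.mul (hρ q)) hks)
    (hsmooth ξ hξ hξs) fun x => ?_
  obtain ⟨q, hqd, hxq⟩ := exists_mem_levelCell ht1 hlf hgen x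
  let c : ULift.{u} (Fin (d + 1)) := ⟨⟨q.1.card, Nat.lt_succ_of_le hqd⟩⟩
  have hval : ∀ (q : Q c) {y}, y ∈ levelCell w t q.1 →
      ∑ᶠ q : Q c, ρ q.1 y = ρ q.1 y ∧ ∑ᶠ q : Q c, (ν q.1 : ℝ) * ρ q.1 y = ν q.1 * ρ q.1 y ∧
      ∑ᶠ q : Q c, ξ q.1 y = ξ q.1 y := fun q y hy =>
    ⟨finsum_eq_of_mem (k := fun (q : Q c) y => ρ q.1 y) (hdisj c) (fun q => (hρs q.1).subset) hy,
      finsum_eq_of_mem (k := fun (q : Q c) y => (ν q.1 : ℝ) * ρ q.1 y) (hdisj c)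
        (fun q => hks q.1) hy,
      finsum_eq_of_mem (k := fun (q : Q c) y => ξ q.1 y) (hdisj c) (fun q => hξs q.1) hy⟩
  have hpos : ∀ q, ∀ y ∈ levelCell w t q, 0 < ρ q y := fun q y hy =>
    (hρ0 q y).lt_of_ne' (show y ∈ Function.support (ρ q) from (hρs q).symm ▸ hy)
  obtain ⟨p, hp⟩ := hchart q ⟨x, hxq⟩
  obtain ⟨e1, e2, -⟩ := hval ⟨q, rfl⟩ hxq
  refine ⟨c, ν q, p, ?_, ?_, fun y hy hlt => ?_⟩
  · simp only [e1]
    exact hpos q x hxq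
  · simp only [e1, e2]
  · obtain ⟨q', hq'⟩ : ∃ q' : Q c, ρ q'.1 y ≠ 0 := by
      by_contra! h
      exact hy.ne' (finsum_eq_zero_of_forall_eq_zero h)
    have hy' : y ∈ levelCell w t q'.1 := hρs q'.1 ▸ hq'
    obtain ⟨f1, f2, f3⟩ := hval q' hy'
    simp only [f1, f2] at hlt
    have hρy := hpos q'.1 y hy'
    have hnn : ν q'.1 = ν q := by
      rw [← sub_mul, abs_mul, abs_of_pos hρy] at hlt
      have h1 : |(ν q'.1 : ℝ) - ν q| < 1 := by
        by_contra! hge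
        nlinarith
      have h2 : |(ν q'.1 : ℤ) - ν q| < 1 := by exact_mod_cast h1
      have h3 := Int.abs_lt_one_iff.1 h2
      omega
    have hqq : q'.1 = q := hν hnn
    simp only [f1, f3, hqq]
    exact hp y (hqq ▸ hy')

end SecondCountable

/-! ### Counting points and components -/

section Cardinality

theorem cardinalMk_real_points_le (d : ℕ) : #(EuclideanSpace ℝ (Fin d)) ≤ 𝔠 := by
  have h : #(EuclideanSpace ℝ (Fin d)) = #(Fin d → ℝ) :=
    Cardinal.mk_congr (WithLp.equiv 2 (Fin d → ℝ))
  rw [h, ← Cardinal.power_def, Cardinal.mk_real, Cardinal.mk_fin]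
  exact (Cardinal.power_le_power_left Cardinal.continuum_ne_zero
    (Cardinal.natCast_le_aleph0 (n := d))).trans_eq Cardinal.continuum_power_aleph0

variable {d : ℕ} {M : Type u} [TopologicalSpace M]
  [ChartedSpace (EuclideanSpace ℝ (Fin d)) M]

/-- The arities of the operations generating a component of a manifold: a base point, the
parametrizations given by the charts, and limits of sequences. -/
def componentArity (d : ℕ) : Unit ⊕ EuclideanSpace ℝ (Fin d) ⊕ Unit → Type
  | .inl _ => Empty
  | .inr (.inl _) => Unit
  | .inr (.inr _) => ℕ

/-- The operations on a manifold of the arities `componentArity`. -/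
noncomputable def componentOp (p : M) : (Σ a, componentArity d a → M) → M
  | ⟨.inl _, _⟩ => p
  | ⟨.inr (.inl z), s⟩ => (chartAt (EuclideanSpace ℝ (Fin d)) (s ())).symm z
  | ⟨.inr (.inr _), s⟩ => @limUnder M _ ℕ ⟨p⟩ atTop s

/-- There are at most `𝔠` operations, all of countable arity, and `𝔠 ^ ℵ₀ = 𝔠`. -/
theorem cardinalMk_componentTerms_le (d : ℕ) : #(WType (componentArity d)) ≤ 𝔠 := by
  refine WType.cardinalMk_le_of_le ?_
  refine (Cardinal.sum_le_sum _ (fun _ => 𝔠) ?_).trans ?_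
  · rintro (_ | _ | _)
    · simpa [componentArity] using Cardinal.one_le_aleph0.trans Cardinal.aleph0_le_continuum
    · simp [componentArity]
    · simp [componentArity]
  · rw [Cardinal.sum_const', Cardinal.mk_sum, Cardinal.mk_sum]
    simp only [Cardinal.lift_id, Cardinal.mk_unit]
    have h1 : (1 : Cardinal.{0}) ≤ 𝔠 := Cardinal.one_le_aleph0.trans Cardinal.aleph0_le_continuum
    refine (mul_le_mul_left
      (add_le_add h1 (add_le_add (cardinalMk_real_points_le d) h1)) 𝔠).trans ?_
    simp

/-- The set of generated points is closed, as it contains limits of its sequences and `M` is first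
countable. It is open, as it contains the chart domain at each of its points. Values at divergent
sequences or outside chart targets are harmless, since only an upper bound on the cardinality is
wanted. -/
theorem connectedComponent_subset_range_componentOp [T2Space M] (p : M) :
    connectedComponent p ⊆ range (WType.elim M (componentOp (d := d) p)) := by
  have : FirstCountableTopology M := ⟨fun x => by
    rw [← (chartAt (EuclideanSpace ℝ (Fin d)) x).symm_map_nhds_eq (mem_chart_source _ x)]
    infer_instance⟩
  refine IsClopen.connectedComponent_subset ⟨?_, ?_⟩ ⟨⟨.inl (), Empty.elim⟩, rfl⟩
  · refine IsSeqClosed.isClosed fun s x hs hx => ?_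
    choose a ha using hs
    refine ⟨⟨.inr (.inr ()), a⟩, ?_⟩
    have hs : (fun n => WType.elim M (componentOp (d := d) p) (a n)) = s := funext ha
    change @limUnder M _ ℕ ⟨p⟩ atTop (fun n => WType.elim M (componentOp (d := d) p) (a n)) = x
    rw [hs]
    exact hx.limUnder_eq
  · refine isOpen_iff_mem_nhds.2 ?_
    rintro _ ⟨a, rfl⟩
    refine mem_of_superset (chart_source_mem_nhds (EuclideanSpace ℝ (Fin d)) _) fun y hy => ?_
    exact ⟨⟨.inr (.inl (chartAt _ (WType.elim M (componentOp p) a) y)), fun _ => a⟩,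
      (chartAt _ (WType.elim M (componentOp p) a)).left_inv hy⟩

theorem cardinalMk_le_of_chartedSpace (d : ℕ) (M : Type u) [TopologicalSpace M] [T2Space M]
    [ChartedSpace (EuclideanSpace ℝ (Fin d)) M] :
    #M ≤ max #(ConnectedComponents M) 𝔠 := by
  rw [← Cardinal.mk_congr (Equiv.sigmaFiberEquiv (ConnectedComponents.mk (α := M))),
    Cardinal.mk_sigma]
  refine (Cardinal.sum_le_sum _ (fun _ => 𝔠) fun c => ?_).trans ?_
  · obtain ⟨p, rfl⟩ := ConnectedComponents.surjective_coe c
    have hsub : {x : M | (x : ConnectedComponents M) = p} ⊆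
        range (WType.elim M (componentOp (d := d) p)) := fun x hx =>
      connectedComponent_subset_range_componentOp p (ConnectedComponents.coe_eq_coe'.1 hx)
    refine (Cardinal.mk_le_mk_of_subset hsub).trans ?_
    have h := Cardinal.mk_range_le_lift (f := WType.elim M (componentOp (d := d) p))
    have h2 := Cardinal.lift_le.{u}.2 (cardinalMk_componentTerms_le d)
    simpa using h.trans h2
  · rw [Cardinal.sum_const']
    exact Cardinal.mul_le_max_of_aleph0_le_right Cardinal.aleph0_le_continuum

/-- Each component is open, so it contains the nonempty trace of a box given by finitely many
coordinates with rational bounds. This finite subset of `I × ℚ × ℚ` determines the component. -/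
theorem cardinalMk_connectedComponents_le_of_isInducing [LocallyConnectedSpace M] {I : Type u}
    {f : M → I → ℝ} (hf : IsInducing f) : #(ConnectedComponents M) ≤ max #I ℵ₀ := by
  have hx : ∀ c : ConnectedComponents M, ∃ s : Finset (I × ℚ × ℚ),
      {x | ∀ q ∈ s, (q.2.1 : ℝ) < f x q.1 ∧ f x q.1 < q.2.2}.Nonempty ∧
      ∀ x, (∀ q ∈ s, (q.2.1 : ℝ) < f x q.1 ∧ f x q.1 < q.2.2) →
        (x : ConnectedComponents M) = c := by
    intro c
    obtain ⟨x, rfl⟩ := ConnectedComponents.surjective_coe c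
    have hn : connectedComponent x ∈ 𝓝 x :=
      isOpen_connectedComponent.mem_nhds mem_connectedComponent
    rw [hf.nhds_eq_comap, mem_comap] at hn
    obtain ⟨V, hV, hVs⟩ := hn
    rw [nhds_pi, Filter.mem_pi] at hV
    obtain ⟨K, hK, W, hW, hWV⟩ := hV
    have hab : ∀ i, ∃ a b : ℚ, (a : ℝ) < f x i ∧ f x i < b ∧ Ioo (a : ℝ) b ⊆ W i := by
      intro i
      obtain ⟨⟨l, u⟩, hlu, hsub⟩ := (nhds_basis_Ioo (f x i)).mem_iff.1 (hW i)
      obtain ⟨a, ha, ha'⟩ := exists_rat_btwn hlu.1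
      obtain ⟨b, hb, hb'⟩ := exists_rat_btwn hlu.2
      exact ⟨a, b, ha', hb, (Ioo_subset_Ioo ha.le hb'.le).trans hsub⟩
    choose a b ha hb hab using hab
    classical
    refine ⟨hK.toFinset.image fun i => (i, a i, b i), ⟨x, ?_⟩, fun y hy => ?_⟩
    · intro q hq
      obtain ⟨i, -, rfl⟩ := Finset.mem_image.1 hq
      exact ⟨ha i, hb i⟩
    · have : y ∈ connectedComponent x := hVs (hWV fun i hi => hab i
        (hy (i, a i, b i) (Finset.mem_image.2 ⟨i, by simpa using hi, rfl⟩)))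
      exact ConnectedComponents.coe_eq_coe'.2 this
  choose s hs hsc using hx
  have hinj : Function.Injective s := fun c c' h => by
    obtain ⟨x, hx⟩ := hs c
    exact (hsc c x hx).symm.trans (hsc c' x (h ▸ hx))
  refine (Cardinal.mk_le_of_injective hinj).trans ?_
  rcases isEmpty_or_nonempty I with hI | hI
  · exact (Cardinal.mk_le_aleph0 (α := Finset (I × ℚ × ℚ))).trans (le_max_right _ _)
  · rw [Cardinal.mk_finset_of_infinite, Cardinal.mk_prod]
    refine (Cardinal.mul_le_max_of_aleph0_le_right (by simp)).trans ?_
    simp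

end Cardinality

/-! ### Bounds for the embedding dimension -/

section EmbeddingDimension

variable {d : ℕ} {r : ℕ∞} {M : Type u} [TopologicalSpace M]
  [ChartedSpace (EuclideanSpace ℝ (Fin d)) M]

theorem IsMBEmbedding.isInducing {E : Type*} [AddCommGroup E] [Module ℝ E] [TopologicalSpace E]
    {f : M → E} (hf : IsMBEmbedding d r f) : IsInducing f := by
  obtain ⟨-, F, -, h, -⟩ := hf
  exact h.isInducing

theorem secondCountableTopology_of_mem_embeddingCardinals {κ : Cardinal.{u}}
    (h : κ ∈ embeddingCardinals d r M) (hκ : κ ≤ ℵ₀) : SecondCountableTopology M := by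
  obtain ⟨I, rfl, f, hf⟩ := h
  have : Countable I := Cardinal.mk_le_aleph0_iff.1 hκ
  exact hf.isInducing.secondCountableTopology

theorem cardinalMk_connectedComponents_le_of_mem_embeddingCardinals {κ : Cardinal.{u}}
    (h : κ ∈ embeddingCardinals d r M) : #(ConnectedComponents M) ≤ max κ ℵ₀ := by
  obtain ⟨I, rfl, f, hf⟩ := h
  have := ChartedSpace.locallyConnectedSpace (EuclideanSpace ℝ (Fin d)) M
  exact cardinalMk_connectedComponents_le_of_isInducing hf.isInducing

theorem exists_mem_embeddingCardinals_le [T2Space M] [IsManifold (𝓡 d) (r : WithTop ℕ∞) M] :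
    ∃ κ ∈ embeddingCardinals d r M, κ ≤ max #(ConnectedComponents M) 𝔠 := by
  obtain ⟨f, hf⟩ := exists_isMBEmbedding_of_points (d := d) (r := r) (M := M)
  refine ⟨_, ⟨_, rfl, f, hf⟩, ?_⟩
  have h1 : ∀ (α : Type) [Countable α], Cardinal.lift.{u} #α ≤ max #(ConnectedComponents M) 𝔠 :=
    fun α _ => by
      have : Cardinal.lift.{u} #α ≤ ℵ₀ := by simp
      exact (this.trans Cardinal.aleph0_le_continuum).trans (le_max_right _ _)
  have h2 := cardinalMk_le_of_chartedSpace d M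
  have h3 : ℵ₀ ≤ max #(ConnectedComponents M) 𝔠 :=
    Cardinal.aleph0_le_continuum.trans (le_max_right _ _)
  rw [Cardinal.mk_sum, Cardinal.mk_prod]
  refine Cardinal.add_le_of_le h3 (by simpa using h1 (Fin d)) ?_
  rw [Cardinal.lift_id'.{0, u}]
  exact Cardinal.mul_le_of_le h3 (by simpa using h2) (h1 _)

end EmbeddingDimension

theorem theoremB (d : ℕ) (r : ℕ∞) (hr : 1 ≤ r)
    (M : Type u) [TopologicalSpace M] [T2Space M]
    [ChartedSpace (EuclideanSpace ℝ (Fin d)) M] [IsManifold (𝓡 d) (r : WithTop ℕ∞) M] :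
    -- some `ℝ^I` admits a `C^r`-embedding of `M`, so that the minimum defining `embdim` exists
    (embeddingCardinals d r M).Nonempty ∧
    (embdim d r M < ℵ₀ ↔ SecondCountableTopology M) ∧
    (¬ SecondCountableTopology M → #(ConnectedComponents M) ≤ 𝔠 →
      ℵ₁ ≤ embdim d r M ∧ embdim d r M ≤ 𝔠) ∧
    (𝔠 ≤ #(ConnectedComponents M) → embdim d r M = #(ConnectedComponents M)) ∧
    embdim d r M ≠ ℵ₀ := by
  obtain ⟨κ, hκ, hκle⟩ := exists_mem_embeddingCardinals_le (d := d) (r := r) (M := M)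
  have hne : (embeddingCardinals d r M).Nonempty := ⟨κ, hκ⟩
  have hmem : embdim d r M ∈ embeddingCardinals d r M := csInf_mem hne
  have hle : embdim d r M ≤ max #(ConnectedComponents M) 𝔠 := (csInf_le' hκ).trans hκle
  have hfin : SecondCountableTopology M → embdim d r M < ℵ₀ := fun _ => by
    obtain ⟨f, hf⟩ := exists_isMBEmbedding_of_secondCountable (d := d) (M := M) hr
    have h : #(Fin d ⊕ ULift.{u} (Fin (d + 1)) × (Bool ⊕ Fin d)) ∈ embeddingCardinals d r M :=
      ⟨_, rfl, f, hf⟩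
    exact (csInf_le' h).trans_lt (Cardinal.lt_aleph0_of_finite _)
  -- Together with `hfin` this leaves a gap: a value at most `ℵ₀` is finite.
  have hsc : embdim d r M ≤ ℵ₀ → SecondCountableTopology M :=
    secondCountableTopology_of_mem_embeddingCardinals hmem
  refine ⟨hne, ⟨fun h => hsc h.le, hfin⟩, fun hns hc => ⟨?_, hle.trans (max_le hc le_rfl)⟩,
    fun hc => ?_, fun h => (hfin (hsc h.le)).ne h⟩
  · rw [← Cardinal.succ_aleph0]
    exact Order.succ_le_of_lt (not_le.1 fun h => hns (hsc h))
  · refine (hle.trans (max_le le_rfl hc)).antisymm ?_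
    -- The alternative `c(M) ≤ ℵ₀` is impossible because `c(M) ≥ 𝔠`.
    refine (le_max_iff.1
      (cardinalMk_connectedComponents_le_of_mem_embeddingCardinals hmem)).resolve_right ?_
    exact not_le.2 (Cardinal.aleph0_lt_continuum.trans_le hc)
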